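/- Let $H$ be a complex Hilbert space. A *JC\*-algebra* on $H$ is a norm-closed complex linear subspace $A\subseteq B(H)$ that is closed under the Jordan product $a\circ b=\tfrac12(ab+ba)$ and under the adjoint $a\mapsto a^*$; it is *unital* if it contains an element $e$ with $\|e\|=1$ and $e\circ a=a$ for all $a\in A$. Let $A\subseteq B(H)$ and $B\subseteq B(K)$ be JC\*-algebras. A map $T:A\to B(K)$ is *completely isometric* if $\|[T(a_{ij})]\|_{M_m(B(K))}=\|[a_{ij}]\|_{M_m(B(H))}$ for all $m\in\mathbb N$ and all $[a_{ij}]\in M_m(A)$; $A$ and $B$ are *linearly completely isometric* if there is a linear completely isometric map of $A$ onto $B$. They are *Jordan isomorphic* if there is a linear bijection $T:A\to B$ with $T(a\circ b)=T(a)\circ T(b)$ for all $a,b\in A$, and *Jordan $*$-isomorphic* if $T$ can in addition be chosen with $T(a^*)=T(a)^*$ for all $a\in A$. 1. There exist unital JC\*-algebras that are linearly completely isometric but not Jordan isomorphic. 2. There exist unital JC\*-algebras that are Jordan $*$-isomorphic but not linearly completely isometric. 3. An example for (2) is the following. Let $n\ge 2$, let $M_n=B(\mathbb C^n)$, and let $R_n=\{(x,x^{\mathsf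 T}) : x\in M_n\}\subseteq M_n\oplus M_n\subseteq B(\mathbb C^n\oplus\mathbb C^n)$. Then $M_n$ and $R_n$ are unital JC\*-algebras, the map $x\mapsto (x,x^{\mathsf T})$ is a Jordan $*$-isomorphism of $M_n$ onto $R_n$, and $M_n$ and $R_n$ are not linearly completely isometric. Moreover the transpose map $x\mapsto x^{\mathsf T}$ on $M_n$ is not completely isometric. -/

import Mathlib

/-- The Jordan product `a ∘ b = (ab + ba) / 2` of two bounded operators. -/
noncomputable def jordanProd {H : Type*} [NormedAddCommGroup H] [InnerProductSpace ℂ H]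
    (a b : H →L[ℂ] H) : H →L[ℂ] H :=
  (2⁻¹ : ℂ) • (a * b + b * a)

/-- A `JC*`-algebra on the complex Hilbert space `H`: a norm-closed linear subspace of `B(H)` that
is closed under the Jordan product and under the adjoint. -/
structure IsJCStarAlgebra {H : Type*} [NormedAddCommGroup H] [InnerProductSpace ℂ H]
    [CompleteSpace H] (A : Submodule ℂ (H →L[ℂ] H)) : Prop where
  isClosed : IsClosed (A : Set (H →L[ℂ] H))
  jordanProd_mem : ∀ a ∈ A, ∀ b ∈ A, jordanProd a b ∈ A
  star_mem : ∀ a ∈ A, star a ∈ A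

/-- A unital `JC*`-algebra: one with an identity element (for the Jordan product) of norm `1`. -/
structure IsUnitalJCStarAlgebra {H : Type*} [NormedAddCommGroup H] [InnerProductSpace ℂ H]
    [CompleteSpace H] (A : Submodule ℂ (H →L[ℂ] H)) : Prop extends IsJCStarAlgebra A where
  exists_unit : ∃ e ∈ A, ‖e‖ = 1 ∧ ∀ a ∈ A, jordanProd e a = a

section Maps

variable {H K : Type*} [NormedAddCommGroup H] [InnerProductSpace ℂ H] [CompleteSpace H]
  [NormedAddCommGroup K] [InnerProductSpace ℂ K] [CompleteSpace K]

/-- `T : A → B(K)` is completely isometric: for every `m` its entrywise action on `m × m` matrices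
over `A` preserves the norm, the norms being the C*-norms of `M_m(B(H))` and `M_m(B(K))`. -/
def IsCompletelyIsometric (A : Submodule ℂ (H →L[ℂ] H)) (T : A → (K →L[ℂ] K)) : Prop :=
  ∀ (m : ℕ) (x : Matrix (Fin m) (Fin m) A),
    ‖CStarMatrix.ofMatrix (x.map T)‖ =
      ‖CStarMatrix.ofMatrix (x.map (fun a : A => (a : H →L[ℂ] H)))‖

/-- `A` and `B` are linearly completely isometric: there is a linear completely isometric map of
`A` onto `B`. -/
def LinearlyCompletelyIsometric (A : Submodule ℂ (H →L[ℂ] H)) (B : Submodule ℂ (K →L[ℂ] K)) :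
    Prop :=
  ∃ T : A ≃ₗ[ℂ] B, IsCompletelyIsometric A (fun a => (T a : K →L[ℂ] K))

/-- A linear bijection `T : A → B` is a Jordan isomorphism if `T (a ∘ b) = T a ∘ T b`. (The element
`c` is `a ∘ b`, regarded as an element of `A`.) -/
def IsJordanIso {A : Submodule ℂ (H →L[ℂ] H)} {B : Submodule ℂ (K →L[ℂ] K)}
    (T : A ≃ₗ[ℂ] B) : Prop :=
  ∀ a b c : A, (c : H →L[ℂ] H) = jordanProd (a : H →L[ℂ] H) b →
    (T c : K →L[ℂ] K) = jordanProd (T a : K →L[ℂ] K) (T b)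

/-- A Jordan `*`-isomorphism is a Jordan isomorphism with `T (a*) = (T a)*`. (The element `c` is
`a*`, regarded as an element of `A`.) -/
def IsJordanStarIso {A : Submodule ℂ (H →L[ℂ] H)} {B : Submodule ℂ (K →L[ℂ] K)}
    (T : A ≃ₗ[ℂ] B) : Prop :=
  IsJordanIso T ∧
    ∀ a c : A, (c : H →L[ℂ] H) = star (a : H →L[ℂ] H) →
      (T c : K →L[ℂ] K) = star (T a : K →L[ℂ] K)

/-- `A` and `B` are Jordan isomorphic (no compatibility with norm or involution is required). -/
def JordanIsomorphic (A : Submodule ℂ (H →L[ℂ] H)) (B : Submodule ℂ (K →L[ℂ] K)) : Prop :=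
  ∃ T : A ≃ₗ[ℂ] B, IsJordanIso T

/-- `A` and `B` are Jordan `*`-isomorphic. -/
def JordanStarIsomorphic (A : Submodule ℂ (H →L[ℂ] H)) (B : Submodule ℂ (K →L[ℂ] K)) : Prop :=
  ∃ T : A ≃ₗ[ℂ] B, IsJordanStarIso T

end Maps

/-- The matrix algebra `M_n`, identified with all of `B(ℂⁿ)`. -/
noncomputable def matrixAlgebra (n : ℕ) :
    Submodule ℂ (EuclideanSpace ℂ (Fin n) →L[ℂ] EuclideanSpace ℂ (Fin n)) := ⊤

/-- The transpose on `M_n = B(ℂⁿ)`. -/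
noncomputable def transposeOp (n : ℕ)
    (x : EuclideanSpace ℂ (Fin n) →L[ℂ] EuclideanSpace ℂ (Fin n)) :
    EuclideanSpace ℂ (Fin n) →L[ℂ] EuclideanSpace ℂ (Fin n) :=
  Matrix.toEuclideanCLM (n := Fin n) (𝕜 := ℂ)
    (Matrix.transpose ((Matrix.toEuclideanCLM (n := Fin n) (𝕜 := ℂ)).symm x))

/-- The linear map `d x = (x, xᵀ)` from `M_n` to `M_n ⊕ M_n`, where `M_n ⊕ M_n` is the algebra of
block diagonal operators on `ℂⁿ ⊕ ℂⁿ`. -/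
noncomputable def diagTranspose (n : ℕ) :
    (EuclideanSpace ℂ (Fin n) →L[ℂ] EuclideanSpace ℂ (Fin n)) →ₗ[ℂ]
      (EuclideanSpace ℂ (Fin n ⊕ Fin n) →L[ℂ] EuclideanSpace ℂ (Fin n ⊕ Fin n)) where
  toFun x :=
    let M := (Matrix.toEuclideanCLM (n := Fin n) (𝕜 := ℂ)).symm x
    Matrix.toEuclideanCLM (n := Fin n ⊕ Fin n) (𝕜 := ℂ)
      (Matrix.fromBlocks M 0 0 (Matrix.transpose M))
  map_add' x y := by
    rw [← map_add]
    simp only [map_add (Matrix.toEuclideanCLM (n := Fin n) (𝕜 := ℂ)).symm, Matrix.transpose_add,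
      Matrix.fromBlocks_add, add_zero]
  map_smul' c x := by
    rw [RingHom.id_apply, ← map_smul]
    simp only [map_smul (Matrix.toEuclideanCLM (n := Fin n) (𝕜 := ℂ)).symm, Matrix.transpose_smul,
      Matrix.fromBlocks_smul, smul_zero]

/-- The algebra `{(x, xᵀ) : x ∈ M_n} ⊆ M_n ⊕ M_n`. -/
noncomputable def diagTransposeAlgebra (n : ℕ) :
    Submodule ℂ (EuclideanSpace ℂ (Fin n ⊕ Fin n) →L[ℂ] EuclideanSpace ℂ (Fin n ⊕ Fin n)) :=
  LinearMap.range (diagTranspose n)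

/-! For the first claim, fix a unitary `w` in a commutative C⋆-algebra `R` and compare the symmetric
`2 × 2` matrices over `R` with those satisfying `x₀₁ = w x₁₀`. Right multiplication by the unitary
`diag(w*, 1)` carries one space onto the other, so they are completely isometric
(`linearlyCompletelyIsometric_twistedSymmetric`). The symmetric matrices contain two anticommuting
involutions. Such a pair in the twisted space makes `w` a square
(`isSquare_of_orthogonal_involutions`), and the coordinate function on the circle has no continuous
square root. A GNS representation turns both spaces into concrete operators.

For the other claims, a complete isometry preserves the norms of two-entry columns and rows, that
is, `‖x*x + y*y‖` and `‖xx* + yy*‖`. On `{(x, xᵀ)}` these two norms agree, since transposing and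
swapping the summands exchanges them. On `M_n`, the pair `e₁₁, e₂₁` has column value 2 and row value
1. -/

section JordanProduct

variable {H : Type*} [NormedAddCommGroup H] [InnerProductSpace ℂ H]

theorem jordanProd_comm (a b : H →L[ℂ] H) : jordanProd a b = jordanProd b a := by
  rw [jordanProd, jordanProd, add_comm]

theorem jordanProd_one_left (a : H →L[ℂ] H) : jordanProd 1 a = a := by
  rw [jordanProd, one_mul, mul_one, ← two_smul ℂ a, smul_smul]
  norm_num

end JordanProduct

/-! ### Norms of rows and columns over a C⋆-algebra, and their invariance under complete isometries.
-/

section RowsAndColumns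

variable {E : Type*} [CStarAlgebra E] [PartialOrder E] [StarOrderedRing E]

/-- The embedding of a C⋆-algebra as the upper left corner of its `2 × 2` matrices. -/
noncomputable def cornerStarAlgHom (E : Type*) [CStarAlgebra E] :
    E →⋆ₙₐ[ℂ] CStarMatrix (Fin 2) (Fin 2) E where
  toFun a := CStarMatrix.ofMatrix !![a, 0; 0, 0]
  map_smul' c a := by ext i j; fin_cases i <;> fin_cases j <;> simp
  map_zero' := by ext i j; fin_cases i <;> fin_cases j <;> simp
  map_add' a b := by ext i j; fin_cases i <;> fin_cases j <;> simp
  map_mul' a b := by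
    ext i j; fin_cases i <;> fin_cases j <;> simp [CStarMatrix.mul_apply]
  map_star' a := by
    ext i j; fin_cases i <;> fin_cases j <;> simp [CStarMatrix.star_apply]

/-- An injective `*`-homomorphism of C⋆-algebras is isometric. -/
theorem norm_corner (a : E) : ‖CStarMatrix.ofMatrix !![a, 0; 0, 0]‖ = ‖a‖ := by
  refine NonUnitalStarAlgHom.norm_map (cornerStarAlgHom E) (fun a b h => ?_) a
  exact congrFun (congrFun h 0) 0

/-- By the C⋆-identity: for the padded column `c`, the product `c* c` lives in the upper left
corner. -/
theorem norm_column_mul_self (x y : E) :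
    ‖CStarMatrix.ofMatrix !![x, 0; y, 0]‖ * ‖CStarMatrix.ofMatrix !![x, 0; y, 0]‖ =
      ‖star x * x + star y * y‖ := by
  rw [← CStarRing.norm_star_mul_self, ← norm_corner (star x * x + star y * y)]
  congr 1
  ext i j
  fin_cases i <;> fin_cases j <;>
    simp [CStarMatrix.mul_apply, CStarMatrix.star_apply]

theorem norm_row_mul_self (x y : E) :
    ‖CStarMatrix.ofMatrix !![x, y; 0, 0]‖ * ‖CStarMatrix.ofMatrix !![x, y; 0, 0]‖ =
      ‖x * star x + y * star y‖ := by
  rw [← CStarRing.norm_self_mul_star, ← norm_corner (x * star x + y * star y)]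
  congr 1
  ext i j
  fin_cases i <;> fin_cases j <;>
    simp [CStarMatrix.mul_apply, CStarMatrix.star_apply]

end RowsAndColumns

section Preservation

variable {H K : Type*} [NormedAddCommGroup H] [InnerProductSpace ℂ H] [CompleteSpace H]
  [NormedAddCommGroup K] [InnerProductSpace ℂ K] [CompleteSpace K]

theorem IsCompletelyIsometric.norm_column {A : Submodule ℂ (H →L[ℂ] H)}
    {T : A → (K →L[ℂ] K)} (hT : IsCompletelyIsometric A T) (h0 : T 0 = 0) (x y : A) :
    ‖star (T x) * T x + star (T y) * T y‖ =
      ‖star (x : H →L[ℂ] H) * x + star (y : H →L[ℂ] H) * y‖ := by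
  rw [← norm_column_mul_self, ← norm_column_mul_self]
  have h := hT 2 !![x, 0; y, 0]
  have h₁ : (!![x, 0; y, 0]).map T = !![T x, 0; T y, 0] := by
    ext1 i j
    fin_cases i <;> fin_cases j <;> simp [h0]
  have h₂ : (!![x, 0; y, 0]).map (fun a : A => (a : H →L[ℂ] H)) =
      !![(x : H →L[ℂ] H), 0; (y : H →L[ℂ] H), 0] := by
    ext1 i j
    fin_cases i <;> fin_cases j <;> simp
  rw [h₁, h₂] at h
  rw [h]

theorem IsCompletelyIsometric.norm_row {A : Submodule ℂ (H →L[ℂ] H)}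
    {T : A → (K →L[ℂ] K)} (hT : IsCompletelyIsometric A T) (h0 : T 0 = 0) (x y : A) :
    ‖T x * star (T x) + T y * star (T y)‖ =
      ‖(x : H →L[ℂ] H) * star (x : H →L[ℂ] H) + (y : H →L[ℂ] H) * star (y : H →L[ℂ] H)‖ := by
  rw [← norm_row_mul_self, ← norm_row_mul_self]
  have h := hT 2 !![x, y; 0, 0]
  have h₁ : (!![x, y; 0, 0]).map T = !![T x, T y; 0, 0] := by
    ext1 i j
    fin_cases i <;> fin_cases j <;> simp [h0]
  have h₂ : (!![x, y; 0, 0]).map (fun a : A => (a : H →L[ℂ] H)) =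
      !![(x : H →L[ℂ] H), (y : H →L[ℂ] H); 0, 0] := by
    ext1 i j
    fin_cases i <;> fin_cases j <;> simp
  rw [h₁, h₂] at h
  rw [h]

end Preservation

/-! ### The transpose as an isometric anti-automorphism, and row-column symmetry on `{(x, xᵀ)}`. -/

section Transpose

open scoped Matrix.Norms.L2Operator

/-- The transpose, followed by a permutation of the indices, as a `*`-homomorphism into the opposite
algebra. -/
noncomputable def transposeReindexStarAlgHom {ι : Type*} [Fintype ι] [DecidableEq ι] (e : ι ≃ ι) :
    Matrix ι ι ℂ →⋆ₙₐ[ℂ] (Matrix ι ι ℂ)ᵐᵒᵖ where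
  toFun M := MulOpposite.op ((M.submatrix e e).transpose)
  map_smul' c a := rfl
  map_zero' := rfl
  map_add' a b := rfl
  map_mul' a b := by
    rw [← MulOpposite.op_mul, ← Matrix.transpose_mul, Matrix.submatrix_mul_equiv]
  map_star' a := rfl

theorem l2_opNorm_transpose_submatrix {ι : Type*} [Fintype ι] [DecidableEq ι] (e : ι ≃ ι)
    (M : Matrix ι ι ℂ) : ‖(M.submatrix e e).transpose‖ = ‖M‖ := by
  refine NonUnitalStarAlgHom.norm_map (transposeReindexStarAlgHom e) (fun a b h => ?_) M
  have h' : (a.submatrix e e).transpose = (b.submatrix e e).transpose := MulOpposite.op_injective h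
  ext i j
  simpa using congrFun (congrFun h' (e.symm j)) (e.symm i)

/-- Transposition reverses products and swaps `M` with `Mᵀ`; exchanging the two blocks undoes the
swap, so column expressions become row expressions. -/
theorem l2_opNorm_row_eq_column_of_diagTranspose {ι : Type*} [Fintype ι] [DecidableEq ι]
    (M N : Matrix ι ι ℂ) :
    ‖star (Matrix.fromBlocks M 0 0 M.transpose) * Matrix.fromBlocks M 0 0 M.transpose +
        star (Matrix.fromBlocks N 0 0 N.transpose) * Matrix.fromBlocks N 0 0 N.transpose‖ =
      ‖Matrix.fromBlocks M 0 0 M.transpose * star (Matrix.fromBlocks M 0 0 M.transpose) +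
        Matrix.fromBlocks N 0 0 N.transpose * star (Matrix.fromBlocks N 0 0 N.transpose)‖ := by
  rw [← l2_opNorm_transpose_submatrix (Equiv.sumComm ι ι)]
  congr 1
  simp only [Matrix.star_eq_conjTranspose, Matrix.fromBlocks_conjTranspose,
    Matrix.fromBlocks_multiply, Matrix.fromBlocks_add, Equiv.sumComm_apply,
    Matrix.fromBlocks_submatrix_sum_swap_sum_swap, Matrix.fromBlocks_transpose]
  simp [Matrix.transpose_mul, Matrix.conjTranspose, Matrix.transpose_map]

end Transpose

/-! ### The pair `M_n` and `{(x, xᵀ)}`. -/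

section MatrixExample

variable (n : ℕ)

theorem diagTranspose_toEuclideanCLM (M : Matrix (Fin n) (Fin n) ℂ) :
    diagTranspose n (Matrix.toEuclideanCLM (n := Fin n) (𝕜 := ℂ) M) =
      Matrix.toEuclideanCLM (n := Fin n ⊕ Fin n) (𝕜 := ℂ)
        (Matrix.fromBlocks M 0 0 M.transpose) := by
  simp [diagTranspose]

theorem exists_toEuclideanCLM_eq {n : ℕ}
    (x : EuclideanSpace ℂ (Fin n) →L[ℂ] EuclideanSpace ℂ (Fin n)) :
    ∃ M, Matrix.toEuclideanCLM (n := Fin n) (𝕜 := ℂ) M = x :=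
  ⟨_, StarAlgEquiv.apply_symm_apply _ x⟩

theorem diagTranspose_injective : Function.Injective (diagTranspose n) := by
  intro x y h
  obtain ⟨M, rfl⟩ := exists_toEuclideanCLM_eq x
  obtain ⟨N, rfl⟩ := exists_toEuclideanCLM_eq y
  rw [diagTranspose_toEuclideanCLM, diagTranspose_toEuclideanCLM] at h
  have h' := (Matrix.toEuclideanCLM (n := Fin n ⊕ Fin n) (𝕜 := ℂ)).injective h
  rw [(Matrix.fromBlocks_inj.mp h').1]

theorem diagTranspose_one : diagTranspose n 1 = 1 := by
  rw [← map_one (Matrix.toEuclideanCLM (n := Fin n) (𝕜 := ℂ)), diagTranspose_toEuclideanCLM,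
    Matrix.transpose_one, Matrix.fromBlocks_one, map_one]

theorem diagTranspose_star (x : EuclideanSpace ℂ (Fin n) →L[ℂ] EuclideanSpace ℂ (Fin n)) :
    diagTranspose n (star x) = star (diagTranspose n x) := by
  obtain ⟨M, rfl⟩ := exists_toEuclideanCLM_eq x
  rw [← map_star, diagTranspose_toEuclideanCLM, diagTranspose_toEuclideanCLM, ← map_star]
  simp only [Matrix.star_eq_conjTranspose, Matrix.fromBlocks_conjTranspose,
    Matrix.conjTranspose_zero]
  rfl

theorem diagTranspose_jordanProd
    (x y : EuclideanSpace ℂ (Fin n) →L[ℂ] EuclideanSpace ℂ (Fin n)) :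
    diagTranspose n (jordanProd x y) = jordanProd (diagTranspose n x) (diagTranspose n y) := by
  obtain ⟨M, rfl⟩ := exists_toEuclideanCLM_eq x
  obtain ⟨N, rfl⟩ := exists_toEuclideanCLM_eq y
  simp only [jordanProd, diagTranspose_toEuclideanCLM, ← map_mul, ← map_add, map_smul]
  simp [Matrix.fromBlocks_multiply, Matrix.fromBlocks_add, Matrix.transpose_mul, add_comm]

theorem isUnitalJCStarAlgebra_matrixAlgebra (hn : n ≠ 0) :
    IsUnitalJCStarAlgebra (matrixAlgebra n) where
  isClosed := isClosed_univ
  jordanProd_mem _ _ _ _ := Submodule.mem_top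
  star_mem _ _ := Submodule.mem_top
  exists_unit := by
    have : NeZero n := ⟨hn⟩
    exact ⟨1, Submodule.mem_top, norm_one, fun a _ => jordanProd_one_left a⟩

theorem isUnitalJCStarAlgebra_diagTransposeAlgebra (hn : n ≠ 0) :
    IsUnitalJCStarAlgebra (diagTransposeAlgebra n) where
  isClosed := Submodule.closed_of_finiteDimensional _
  jordanProd_mem := by
    rintro _ ⟨x, rfl⟩ _ ⟨y, rfl⟩
    exact ⟨_, diagTranspose_jordanProd n x y⟩
  star_mem := by
    rintro _ ⟨x, rfl⟩
    exact ⟨_, diagTranspose_star n x⟩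
  exists_unit := by
    have : NeZero n := ⟨hn⟩
    exact ⟨1, ⟨1, diagTranspose_one n⟩, norm_one, fun a _ => jordanProd_one_left a⟩

/-- The map `x ↦ (x, xᵀ)` of `M_n` onto its range. -/
noncomputable def diagTransposeEquiv : matrixAlgebra n ≃ₗ[ℂ] diagTransposeAlgebra n :=
  Submodule.topEquiv.trans (LinearEquiv.ofInjective _ (diagTranspose_injective n))

theorem diagTransposeEquiv_apply (x : matrixAlgebra n) :
    (diagTransposeEquiv n x : EuclideanSpace ℂ (Fin n ⊕ Fin n) →L[ℂ] _) = diagTranspose n x := rfl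

theorem isJordanStarIso_diagTransposeEquiv : IsJordanStarIso (diagTransposeEquiv n) := by
  refine ⟨fun a b c h => ?_, fun a c h => ?_⟩
  · simp only [diagTransposeEquiv_apply, h, diagTranspose_jordanProd]
  · simp only [diagTransposeEquiv_apply, h, diagTranspose_star]

theorem norm_column_eq_norm_row_of_mem_diagTransposeAlgebra
    {x y : EuclideanSpace ℂ (Fin n ⊕ Fin n) →L[ℂ] EuclideanSpace ℂ (Fin n ⊕ Fin n)}
    (hx : x ∈ diagTransposeAlgebra n) (hy : y ∈ diagTransposeAlgebra n) :
    ‖star x * x + star y * y‖ = ‖x * star x + y * star y‖ := by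
  obtain ⟨x, rfl⟩ := hx
  obtain ⟨y, rfl⟩ := hy
  obtain ⟨M, rfl⟩ := exists_toEuclideanCLM_eq x
  obtain ⟨N, rfl⟩ := exists_toEuclideanCLM_eq y
  simp only [diagTranspose_toEuclideanCLM]
  simp only [← map_star (Matrix.toEuclideanCLM (n := Fin n ⊕ Fin n) (𝕜 := ℂ)), ← map_mul,
    ← map_add]
  exact l2_opNorm_row_eq_column_of_diagTranspose M N

/-- The matrix unit `e_{ij}` as an operator. -/
noncomputable def matrixUnit {n : ℕ} (i j : Fin n) :
    EuclideanSpace ℂ (Fin n) →L[ℂ] EuclideanSpace ℂ (Fin n) :=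
  Matrix.toEuclideanCLM (n := Fin n) (𝕜 := ℂ) (Matrix.single i j 1)

variable {n}

theorem star_matrixUnit (i j : Fin n) : star (matrixUnit i j) = matrixUnit j i := by
  rw [matrixUnit, ← map_star, Matrix.star_eq_conjTranspose, Matrix.conjTranspose_single, star_one,
    matrixUnit]

theorem matrixUnit_mul (i j k : Fin n) : matrixUnit i j * matrixUnit j k = matrixUnit i k := by
  rw [matrixUnit, matrixUnit, ← map_mul, Matrix.single_mul_single_same, one_mul, matrixUnit]

theorem transposeOp_matrixUnit (i j : Fin n) :
    transposeOp n (matrixUnit i j) = matrixUnit j i := by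
  simp [transposeOp, matrixUnit]

theorem norm_matrixUnit_add_self (i : Fin n) : ‖matrixUnit i i + matrixUnit i i‖ = 2 := by
  rw [matrixUnit, ← map_add, ← Matrix.diagonal_single, Matrix.diagonal_add,
    ← Matrix.cstar_norm_def, Matrix.l2_opNorm_diagonal, ← Pi.add_def, ← Pi.single_add, Pi.norm_single]
  norm_num

theorem norm_matrixUnit_add_le {i j : Fin n} (h : i ≠ j) :
    ‖matrixUnit i i + matrixUnit j j‖ ≤ 1 := by
  rw [matrixUnit, matrixUnit, ← map_add, ← Matrix.diagonal_single, ← Matrix.diagonal_single,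
    Matrix.diagonal_add, ← Matrix.cstar_norm_def, Matrix.l2_opNorm_diagonal,
    pi_norm_le_iff_of_nonneg zero_le_one]
  intro k
  rcases eq_or_ne k i with rfl | hi
  · simp [h]
  · rcases eq_or_ne k j with rfl | hj
    · simp [hi]
    · simp [hi, hj]

theorem norm_column_matrixUnit (i j : Fin n) :
    ‖star (matrixUnit i i) * matrixUnit i i + star (matrixUnit j i) * matrixUnit j i‖ = 2 := by
  rw [star_matrixUnit, star_matrixUnit, matrixUnit_mul, matrixUnit_mul, norm_matrixUnit_add_self]

theorem norm_row_matrixUnit_le {i j : Fin n} (h : i ≠ j) :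
    ‖matrixUnit i i * star (matrixUnit i i) + matrixUnit j i * star (matrixUnit j i)‖ ≤ 1 := by
  rw [star_matrixUnit, star_matrixUnit, matrixUnit_mul, matrixUnit_mul]
  exact norm_matrixUnit_add_le h

theorem not_linearlyCompletelyIsometric_diagTransposeAlgebra (hn : 2 ≤ n) :
    ¬ LinearlyCompletelyIsometric (matrixAlgebra n) (diagTransposeAlgebra n) := by
  rintro ⟨T, hT⟩
  let i : Fin n := ⟨0, by lia⟩
  let j : Fin n := ⟨1, by lia⟩
  have hij : i ≠ j := by simp [i, j]
  let x : matrixAlgebra n := ⟨matrixUnit i i, Submodule.mem_top⟩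
  let y : matrixAlgebra n := ⟨matrixUnit j i, Submodule.mem_top⟩
  have h0 : (T 0 : EuclideanSpace ℂ (Fin n ⊕ Fin n) →L[ℂ] EuclideanSpace ℂ (Fin n ⊕ Fin n)) = 0 := by
    rw [T.map_zero, Submodule.coe_zero]
  have hc := hT.norm_column h0 x y
  have hr := hT.norm_row h0 x y
  rw [norm_column_eq_norm_row_of_mem_diagTransposeAlgebra n (T x).2 (T y).2, hr] at hc
  linarith [norm_column_matrixUnit i j, norm_row_matrixUnit_le hij]

theorem not_isCompletelyIsometric_transposeOp (hn : 2 ≤ n) :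
    ¬ IsCompletelyIsometric (matrixAlgebra n) (fun x => transposeOp n x) := by
  intro hT
  let i : Fin n := ⟨0, by lia⟩
  let j : Fin n := ⟨1, by lia⟩
  have hij : i ≠ j := by simp [i, j]
  let x : matrixAlgebra n := ⟨matrixUnit i i, Submodule.mem_top⟩
  -- The transposes of `x`, `y` are `e_ii`, `e_ji`, whose column value is 2, while that of `x`, `y`
  -- themselves is at most 1.
  let y : matrixAlgebra n := ⟨matrixUnit i j, Submodule.mem_top⟩
  have hc := hT.norm_column (by simp [transposeOp]) x y
  simp only [x, y, transposeOp_matrixUnit, norm_column_matrixUnit] at hc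
  simp only [star_matrixUnit, matrixUnit_mul] at hc
  linarith [norm_matrixUnit_add_le hij]

end MatrixExample

/-! ### A faithful GNS representation of the `2 × 2` matrices over `C(X)`. -/

section Representation

open MeasureTheory
open scoped ComplexOrder

/-- The image of `a` sends the class of `1` to a vector of squared norm `f (a* a)`. -/
theorem PositiveLinearMap.gnsStarAlgHom_injective {E : Type*} [CStarAlgebra E] [PartialOrder E]
    [StarOrderedRing E] (f : E →ₚ[ℂ] ℂ) (hf : ∀ a, f (star a * a) = 0 → a = 0) :
    Function.Injective f.gnsStarAlgHom := by
  rw [injective_iff_map_eq_zero]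
  intro a ha
  apply hf
  have h : f.gnsNonUnitalStarAlgHom a (f.toPreGNS 1 : f.PreGNS) = 0 := by
    change f.gnsStarAlgHom a (f.toPreGNS 1 : f.PreGNS) = 0
    rw [ha]; rfl
  rw [PositiveLinearMap.gnsNonUnitalStarAlgHom_apply_coe] at h
  have h' := congrArg norm h
  rw [UniformSpace.Completion.norm_coe, norm_zero] at h'
  have h'' := f.preGNS_norm_sq (f.leftMulMapPreGNS a (f.toPreGNS 1))
  rw [h'] at h''
  simpa using h''.symm

variable {X : Type*} [TopologicalSpace X] [CompactSpace X] [MeasurableSpace X] [BorelSpace X]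

/-- The functional on `2 × 2` matrices over `C(X)` that integrates the trace. -/
noncomputable def integralTrace (μ : Measure X) [IsFiniteMeasure μ] :
    CStarMatrix (Fin 2) (Fin 2) C(X, ℂ) →ₗ[ℂ] ℂ where
  toFun x := ∫ t, (x 0 0 + x 1 1) t ∂μ
  map_add' x y := by
    rw [← integral_add]
    · congr 1 with t
      simp only [CStarMatrix.add_apply, ContinuousMap.add_apply]
      ring
    all_goals
      exact (ContinuousMap.continuous _).integrable_of_hasCompactSupport
        (HasCompactSupport.of_compactSpace _)
  map_smul' c x := by
    rw [RingHom.id_apply, ← integral_smul]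
    congr 1 with t
    simp [mul_add]

theorem integralTrace_star_mul_self (μ : Measure X) [IsFiniteMeasure μ]
    (x : CStarMatrix (Fin 2) (Fin 2) C(X, ℂ)) :
    integralTrace μ (star x * x) =
      ((∫ t, (‖x 0 0 t‖ ^ 2 + ‖x 1 0 t‖ ^ 2 + ‖x 0 1 t‖ ^ 2 + ‖x 1 1 t‖ ^ 2) ∂μ : ℝ) : ℂ) := by
  rw [← integral_complex_ofReal]
  change ∫ t, _ ∂μ = _
  congr 1 with t
  simp [CStarMatrix.mul_apply, CStarMatrix.star_apply, Fin.sum_univ_two, ← Complex.conj_mul']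
  ring

theorem integralTrace_nonneg (μ : Measure X) [IsFiniteMeasure μ]
    (x : CStarMatrix (Fin 2) (Fin 2) C(X, ℂ)) (hx : 0 ≤ x) : 0 ≤ integralTrace μ x := by
  rw [StarOrderedRing.nonneg_iff] at hx
  induction hx using AddSubmonoid.closure_induction with
  | mem x hx =>
    obtain ⟨y, rfl⟩ := hx
    rw [integralTrace_star_mul_self]
    exact Complex.zero_le_real.mpr (integral_nonneg fun t => by positivity)
  | zero => rw [map_zero]
  | add x y _ _ hx hy => rw [map_add]; exact add_nonneg hx hy

/-- The integrand is continuous and nonnegative, and `μ` charges every nonempty open set, so a zero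
integral makes all four entries vanish everywhere. -/
theorem eq_zero_of_integralTrace_star_mul_self (μ : Measure X) [IsFiniteMeasure μ]
    [μ.IsOpenPosMeasure] (x : CStarMatrix (Fin 2) (Fin 2) C(X, ℂ))
    (hx : integralTrace μ (star x * x) = 0) : x = 0 := by
  rw [integralTrace_star_mul_self, Complex.ofReal_eq_zero] at hx
  have hc : Continuous fun t =>
      ‖x 0 0 t‖ ^ 2 + ‖x 1 0 t‖ ^ 2 + ‖x 0 1 t‖ ^ 2 + ‖x 1 1 t‖ ^ 2 := by fun_prop
  rw [integral_eq_zero_iff_of_nonneg (fun t => by positivity)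
    (hc.integrable_of_hasCompactSupport (HasCompactSupport.of_compactSpace _))] at hx
  have h := congrFun ((hc.ae_eq_iff_eq μ continuous_zero).mp hx)
  ext i j t
  have ht := h t
  simp only [Pi.zero_apply] at ht
  suffices ‖x i j t‖ ^ 2 = 0 by simpa using this
  have h₁ := sq_nonneg ‖x 0 0 t‖
  have h₂ := sq_nonneg ‖x 1 0 t‖
  have h₃ := sq_nonneg ‖x 0 1 t‖
  have h₄ := sq_nonneg ‖x 1 1 t‖
  fin_cases i <;> fin_cases j <;> simp only [Fin.zero_eta, Fin.mk_one] <;> linarith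

theorem exists_faithful_representation_matrix_continuousMap {X : Type} [TopologicalSpace X]
    [CompactSpace X] [MeasurableSpace X] [BorelSpace X] (μ : Measure X) [IsFiniteMeasure μ]
    [μ.IsOpenPosMeasure] :
    ∃ (H : Type) (_ : NormedAddCommGroup H) (_ : InnerProductSpace ℂ H) (_ : CompleteSpace H)
      (π : CStarMatrix (Fin 2) (Fin 2) C(X, ℂ) →⋆ₐ[ℂ] (H →L[ℂ] H)), Function.Injective π := by
  let f : CStarMatrix (Fin 2) (Fin 2) C(X, ℂ) →ₚ[ℂ] ℂ :=
    PositiveLinearMap.mk₀ (integralTrace μ) (integralTrace_nonneg μ)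
  exact ⟨f.GNS, inferInstance, inferInstance, inferInstance, f.gnsStarAlgHom,
    f.gnsStarAlgHom_injective (eq_zero_of_integralTrace_star_mul_self μ)⟩

end Representation

/-! ### Transport along a faithful representation, and right multiplication by a unitary. -/

section Isotope

variable {H : Type*} [NormedAddCommGroup H] [InnerProductSpace ℂ H] [CompleteSpace H]

theorem isUnitalJCStarAlgebra_map {E : Type*} [CStarAlgebra E] [Nontrivial E]
    (π : E →⋆ₐ[ℂ] (H →L[ℂ] H)) (hπ : Function.Injective π) (S : Submodule ℂ E)
    (hc : IsClosed (S : Set E)) (hj : ∀ a ∈ S, ∀ b ∈ S, a * b + b * a ∈ S)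
    (hs : ∀ a ∈ S, star a ∈ S) (h1 : (1 : E) ∈ S) :
    IsUnitalJCStarAlgebra (S.map (π : E →ₗ[ℂ] (H →L[ℂ] H))) where
  isClosed := (NonUnitalStarAlgHom.isometry π hπ).isClosedEmbedding.isClosedMap _ hc
  jordanProd_mem := by
    rintro _ ⟨a, ha, rfl⟩ _ ⟨b, hb, rfl⟩
    refine ⟨(2⁻¹ : ℂ) • (a * b + b * a), S.smul_mem _ (hj a ha b hb), ?_⟩
    simp [jordanProd]
  star_mem := by
    rintro _ ⟨a, ha, rfl⟩
    exact ⟨star a, hs a ha, map_star π a⟩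
  exists_unit := by
    refine ⟨1, ⟨1, h1, map_one π⟩, ?_, fun a _ => jordanProd_one_left a⟩
    rw [← map_one π, NonUnitalStarAlgHom.norm_map π hπ, norm_one]

/-- On `m × m` matrices the map is again right multiplication by a unitary, namely `diag(u, …, u)`.
-/
theorem linearlyCompletelyIsometric_map_mulRight (A : Submodule ℂ (H →L[ℂ] H))
    {u : H →L[ℂ] H} (hu : u ∈ unitary (H →L[ℂ] H)) :
    LinearlyCompletelyIsometric A (A.map (LinearMap.mulRight ℂ u)) := by
  have hinj : Function.Injective (LinearMap.mulRight ℂ u) := fun a b h => by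
    have h' : a * u * star u = b * u * star u := congrArg (· * star u) h
    simpa [mul_assoc, Unitary.mul_star_self_of_mem hu] using h'
  refine ⟨Submodule.equivMapOfInjective _ hinj A, fun m x => ?_⟩
  let U : CStarMatrix (Fin m) (Fin m) (H →L[ℂ] H) :=
    CStarMatrix.ofMatrix (Matrix.diagonal fun _ => u)
  have hU : U ∈ unitary (CStarMatrix (Fin m) (Fin m) (H →L[ℂ] H)) := by
    rw [Unitary.mem_iff]
    have hs : star U = CStarMatrix.ofMatrix (Matrix.diagonal fun _ => star u) :=
      Matrix.diagonal_conjTranspose _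
    rw [hs]
    constructor
    · refine (Matrix.diagonal_mul_diagonal _ _).trans ?_
      simp only [Unitary.star_mul_self_of_mem hu]
      exact Matrix.diagonal_one
    · refine (Matrix.diagonal_mul_diagonal _ _).trans ?_
      simp only [Unitary.mul_star_self_of_mem hu]
      exact Matrix.diagonal_one
  refine Eq.trans ?_ (CStarRing.norm_mul_mem_unitary
    (CStarMatrix.ofMatrix (x.map (fun a : A => (a : H →L[ℂ] H)))) hU)
  congr 1
  ext1 i j
  exact (Matrix.mul_diagonal (fun _ => u) (x.map (fun a : A => (a : H →L[ℂ] H))) i j).symm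

end Isotope

/-! ### Twisted symmetric matrices and the square-root obstruction. -/

section TwistedSymmetric

variable {R : Type*} [CommCStarAlgebra R]

/-- The `2 × 2` matrices `x` over `R` with `x₀₁ = w x₁₀`. -/
def twistedSymmetric (w : R) : Submodule ℂ (CStarMatrix (Fin 2) (Fin 2) R) where
  carrier := {x | x 0 1 = w * x 1 0}
  add_mem' {x y} hx hy := by
    simp only [Set.mem_ofPred_eq, CStarMatrix.add_apply] at *
    rw [hx, hy, mul_add]
  zero_mem' := by simp
  smul_mem' c x hx := by
    simp only [Set.mem_ofPred_eq, CStarMatrix.smul_apply] at *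
    rw [hx, mul_smul_comm]

theorem mem_twistedSymmetric {w : R} {x : CStarMatrix (Fin 2) (Fin 2) R} :
    x ∈ twistedSymmetric w ↔ x 0 1 = w * x 1 0 := Iff.rfl

theorem isClosed_twistedSymmetric (w : R) :
    IsClosed (twistedSymmetric w : Set (CStarMatrix (Fin 2) (Fin 2) R)) := by
  have h (i j : Fin 2) : Continuous fun x : CStarMatrix (Fin 2) (Fin 2) R => x i j :=
    continuous_apply_apply (ρ := fun _ _ => R) i j
  exact isClosed_eq (h 0 1) (continuous_const.mul (h 1 0))

theorem mul_add_mul_mem_twistedSymmetric {w : R} {x y : CStarMatrix (Fin 2) (Fin 2) R}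
    (hx : x ∈ twistedSymmetric w) (hy : y ∈ twistedSymmetric w) :
    x * y + y * x ∈ twistedSymmetric w := by
  rw [mem_twistedSymmetric] at *
  simp only [CStarMatrix.add_apply, CStarMatrix.mul_apply, Fin.sum_univ_two, hx, hy]
  ring

theorem star_mem_twistedSymmetric {w : R} (hw : w * star w = 1)
    {x : CStarMatrix (Fin 2) (Fin 2) R} (hx : x ∈ twistedSymmetric w) :
    star x ∈ twistedSymmetric w := by
  rw [mem_twistedSymmetric] at *
  rw [CStarMatrix.star_apply, CStarMatrix.star_apply, hx, star_mul', ← mul_assoc, hw, one_mul]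

theorem one_mem_twistedSymmetric (w : R) : 1 ∈ twistedSymmetric w := by
  simp [mem_twistedSymmetric]

/-- The diagonal matrix with entries `star w` and `1`. -/
def twistUnitary (w : R) : CStarMatrix (Fin 2) (Fin 2) R :=
  CStarMatrix.ofMatrix !![star w, 0; 0, 1]

theorem twistUnitary_mem_unitary {w : R} (hw : w * star w = 1) :
    twistUnitary w ∈ unitary (CStarMatrix (Fin 2) (Fin 2) R) := by
  have hw' : star w * w = 1 := by rw [mul_comm, hw]
  rw [Unitary.mem_iff]
  constructor <;> ext i j <;> fin_cases i <;> fin_cases j <;>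
    simp [twistUnitary, CStarMatrix.mul_apply, CStarMatrix.star_apply, hw, hw']

/-- Multiplying by `twistUnitary w` scales the first column by `star w`, which makes `x₁₀` equal to
`star w` times `x₀₁`. -/
theorem map_mulRight_twistedSymmetric_one {w : R} (hw : w * star w = 1) :
    (twistedSymmetric (1 : R)).map (LinearMap.mulRight ℂ (twistUnitary w)) =
      twistedSymmetric w := by
  have hw' : star w * w = 1 := by rw [mul_comm, hw]
  apply le_antisymm
  · rintro _ ⟨x, hx, rfl⟩
    have hx' : x 0 1 = 1 * x 1 0 := hx
    rw [mem_twistedSymmetric, LinearMap.mulRight_apply]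
    simp [CStarMatrix.mul_apply, twistUnitary, hx', mul_left_comm w, hw]
  · intro x hx
    rw [mem_twistedSymmetric] at hx
    refine ⟨x * star (twistUnitary w), ?_, ?_⟩
    · change (x * star (twistUnitary w)) 0 1 = 1 * (x * star (twistUnitary w)) 1 0
      simp [CStarMatrix.mul_apply, CStarMatrix.star_apply, twistUnitary, hx, mul_comm]
    · rw [LinearMap.mulRight_apply, mul_assoc,
        Unitary.star_mul_self_of_mem (twistUnitary_mem_unitary hw), mul_one]

theorem isUnitalJCStarAlgebra_map_twistedSymmetric [PartialOrder R] [StarOrderedRing R]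
    [Nontrivial R] {H : Type*} [NormedAddCommGroup H] [InnerProductSpace ℂ H] [CompleteSpace H]
    (π : CStarMatrix (Fin 2) (Fin 2) R →⋆ₐ[ℂ] (H →L[ℂ] H)) (hπ : Function.Injective π)
    {w : R} (hw : w * star w = 1) :
    IsUnitalJCStarAlgebra
      ((twistedSymmetric w).map (π : CStarMatrix (Fin 2) (Fin 2) R →ₗ[ℂ] (H →L[ℂ] H))) :=
  isUnitalJCStarAlgebra_map π hπ _ (isClosed_twistedSymmetric w)
    (fun _ ha _ hb => mul_add_mul_mem_twistedSymmetric ha hb)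
    (fun _ ha => star_mem_twistedSymmetric hw ha) (one_mem_twistedSymmetric w)

theorem linearlyCompletelyIsometric_twistedSymmetric
    {H : Type*} [NormedAddCommGroup H] [InnerProductSpace ℂ H] [CompleteSpace H]
    (π : CStarMatrix (Fin 2) (Fin 2) R →⋆ₐ[ℂ] (H →L[ℂ] H)) {w : R} (hw : w * star w = 1) :
    LinearlyCompletelyIsometric
      ((twistedSymmetric (1 : R)).map (π : CStarMatrix (Fin 2) (Fin 2) R →ₗ[ℂ] (H →L[ℂ] H)))
      ((twistedSymmetric w).map (π : CStarMatrix (Fin 2) (Fin 2) R →ₗ[ℂ] (H →L[ℂ] H))) := by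
  have h := linearlyCompletelyIsometric_map_mulRight
    ((twistedSymmetric (1 : R)).map (π : CStarMatrix (Fin 2) (Fin 2) R →ₗ[ℂ] (H →L[ℂ] H)))
    (Unitary.map_mem π (twistUnitary_mem_unitary hw))
  have hcomp : LinearMap.mulRight ℂ (π (twistUnitary w)) ∘ₗ
        (π : CStarMatrix (Fin 2) (Fin 2) R →ₗ[ℂ] (H →L[ℂ] H)) =
      (π : CStarMatrix (Fin 2) (Fin 2) R →ₗ[ℂ] (H →L[ℂ] H)) ∘ₗ
        LinearMap.mulRight ℂ (twistUnitary w) :=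
    LinearMap.ext fun x => (map_mul π x (twistUnitary w)).symm
  rwa [← Submodule.map_comp, hcomp, Submodule.map_comp,
    map_mulRight_twistedSymmetric_one hw] at h

/-- Adjoin formally `s` with `s² = w`. The `(0,0)` entries of the three relations say that the rows
`(a, s b)` and `(c, s d)` are orthonormal. The squared determinant is then 1, so `w (ad - cb)² = 1`
and `w = (w (ad - cb))²`. -/
theorem isSquare_of_orthogonal_involutions {w : R} {p q : CStarMatrix (Fin 2) (Fin 2) R}
    (hp : p ∈ twistedSymmetric w) (hq : q ∈ twistedSymmetric w) (hpp : p * p = 1)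
    (hqq : q * q = 1) (hpq : p * q + q * p = 0) : IsSquare w := by
  rw [mem_twistedSymmetric] at hp hq
  have h₁ : (p * p) 0 0 = 1 := by rw [hpp, CStarMatrix.one_apply_eq]
  have h₂ : (q * q) 0 0 = 1 := by rw [hqq, CStarMatrix.one_apply_eq]
  have h₃ : (p * q + q * p) 0 0 = 0 := by rw [hpq, CStarMatrix.zero_apply]
  simp only [CStarMatrix.add_apply, CStarMatrix.mul_apply, Fin.sum_univ_two, hp, hq] at h₁ h₂ h₃
  generalize p 0 0 = a, p 1 0 = b, q 0 0 = c, q 1 0 = d at h₁ h₂ h₃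
  have h₄ : a * c + w * b * d = 0 := by
    have : (2 : ℂ) • (a * c + w * b * d) = 0 := by
      rw [two_smul]
      linear_combination h₃
    exact (smul_eq_zero_iff_right two_ne_zero).mp this
  -- Orthonormal rows force orthonormal columns; this is the norm of the second column.
  have h₅ : w * (b * b + d * d) = 1 := by
    linear_combination c * c * h₁ + (1 - w * b * b) * h₂ - (a * c - w * b * d) * h₄
  refine ⟨w * (a * d - c * b), ?_⟩
  linear_combination -w ^ 2 * (d ^ 2 * h₁ + b ^ 2 * h₂ - 2 * b * d * h₄) - w * h₅

/-- The anticommuting involutions `σ`, `τ` are described by Jordan products and the unit alone, so a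
Jordan isomorphism would carry them to such a pair in the twisted space. -/
theorem not_jordanIsomorphic_twistedSymmetric {w : R} (hw : ¬ IsSquare w)
    {H : Type*} [NormedAddCommGroup H] [InnerProductSpace ℂ H] [CompleteSpace H]
    (π : CStarMatrix (Fin 2) (Fin 2) R →⋆ₐ[ℂ] (H →L[ℂ] H)) (hπ : Function.Injective π) :
    ¬ JordanIsomorphic
      ((twistedSymmetric (1 : R)).map (π : CStarMatrix (Fin 2) (Fin 2) R →ₗ[ℂ] (H →L[ℂ] H)))
      ((twistedSymmetric w).map (π : CStarMatrix (Fin 2) (Fin 2) R →ₗ[ℂ] (H →L[ℂ] H))) := by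
  rintro ⟨T, hT⟩
  let σ : CStarMatrix (Fin 2) (Fin 2) R := CStarMatrix.ofMatrix !![1, 0; 0, -1]
  let τ : CStarMatrix (Fin 2) (Fin 2) R := CStarMatrix.ofMatrix !![0, 1; 1, 0]
  have hσ : σ ∈ twistedSymmetric (1 : R) := by simp [mem_twistedSymmetric, σ]
  have hτ : τ ∈ twistedSymmetric (1 : R) := by simp [mem_twistedSymmetric, τ]
  have hσσ : σ * σ = 1 := by
    ext i j; fin_cases i <;> fin_cases j <;> simp [σ, CStarMatrix.mul_apply]
  have hττ : τ * τ = 1 := by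
    ext i j; fin_cases i <;> fin_cases j <;> simp [τ, CStarMatrix.mul_apply]
  have hστ : σ * τ + τ * σ = 0 := by
    ext i j; fin_cases i <;> fin_cases j <;> simp [σ, τ, CStarMatrix.mul_apply]
  have hT' {x y v : CStarMatrix (Fin 2) (Fin 2) R} (hx : x ∈ twistedSymmetric (1 : R))
      (hy : y ∈ twistedSymmetric (1 : R)) (hv : v ∈ twistedSymmetric (1 : R))
      (h : x * y + y * x = (2 : ℂ) • v) :
      (T ⟨π v, v, hv, rfl⟩ : H →L[ℂ] H) =
        jordanProd (T ⟨π x, x, hx, rfl⟩ : H →L[ℂ] H) (T ⟨π y, y, hy, rfl⟩) := by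
    refine hT _ _ _ ?_
    rw [jordanProd, ← map_mul, ← map_mul, ← map_add, h, map_smul, smul_smul]
    norm_num
  have hmul {x y v : CStarMatrix (Fin 2) (Fin 2) R} (h : π v = jordanProd (π x) (π y)) :
      x * y + y * x = (2 : ℂ) • v := by
    apply hπ
    rw [map_smul, h, jordanProd, smul_smul, map_add, map_mul, map_mul]
    norm_num
  have h1 := one_mem_twistedSymmetric (1 : R)
  -- If `T v = 1`, then `1 = T (1 ∘ v) = T 1 ∘ 1 = T 1`.
  have hT1 : (T ⟨π 1, 1, h1, rfl⟩ : H →L[ℂ] H) = π 1 := by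
    obtain ⟨⟨_, v, hv, rfl⟩, hTv⟩ := T.surjective ⟨π 1, 1, one_mem_twistedSymmetric w, rfl⟩
    have h := hT' h1 hv hv (by rw [one_mul, mul_one, two_smul])
    have h' : (T ⟨π v, v, hv, rfl⟩ : H →L[ℂ] H) = π 1 := congrArg Subtype.val hTv
    rw [h'] at h
    have hr (a : H →L[ℂ] H) : jordanProd a (π 1) = a := by
      rw [map_one, jordanProd_comm, jordanProd_one_left]
    exact (h.trans (hr _)).symm
  obtain ⟨p, hp, hTp⟩ := (T ⟨π σ, σ, hσ, rfl⟩).2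
  obtain ⟨q, hq, hTq⟩ := (T ⟨π τ, τ, hτ, rfl⟩).2
  have hTp' : (T ⟨π σ, σ, hσ, rfl⟩ : H →L[ℂ] H) = π p := hTp.symm
  have hTq' : (T ⟨π τ, τ, hτ, rfl⟩ : H →L[ℂ] H) = π q := hTq.symm
  have hpp := hT' hσ hσ h1 (by rw [hσσ, two_smul])
  have hqq := hT' hτ hτ h1 (by rw [hττ, two_smul])
  have hpq := hT' hσ hτ (zero_mem _) (by rw [hστ, smul_zero])
  have hT0 : (T ⟨π 0, 0, zero_mem _, rfl⟩ : H →L[ℂ] H) = π 0 := by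
    have h0 : (⟨π 0, 0, zero_mem _, rfl⟩ : (twistedSymmetric (1 : R)).map
        (π : CStarMatrix (Fin 2) (Fin 2) R →ₗ[ℂ] (H →L[ℂ] H))) = 0 := Subtype.ext (map_zero π)
    rw [h0, T.map_zero, map_zero, Submodule.coe_zero]
  rw [hT1, hTp'] at hpp
  rw [hT1, hTq'] at hqq
  rw [hT0, hTp', hTq'] at hpq
  refine hw (isSquare_of_orthogonal_involutions hp hq ?_ ?_ ?_)
  · have h := hmul hpp
    rw [← two_smul ℂ] at h
    exact smul_right_injective _ (two_ne_zero (α := ℂ)) h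
  · have h := hmul hqq
    rw [← two_smul ℂ] at h
    exact smul_right_injective _ (two_ne_zero (α := ℂ)) h
  · rw [hmul hpq, smul_zero]

end TwistedSymmetric

/-! ### The circle, and assembly of the results. -/

/-- Lifted to the connected line, a square root must be `exp (π i t)` up to one global sign; that
function changes sign between `0` and `1`, whereas the root has period 1. -/
theorem not_isSquare_fourier_one : ¬ IsSquare (fourier 1 : C(UnitAddCircle, ℂ)) := by
  rintro ⟨y, hy⟩
  have hne (t : ℝ) : Complex.exp (Real.pi * Complex.I * t) ≠ 0 := Complex.exp_ne_zero _
  have hsq : Set.EqOn ((fun t : ℝ => y t) ^ 2)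
      ((fun t : ℝ => Complex.exp (Real.pi * Complex.I * t)) ^ 2) Set.univ := fun t _ => by
    have h : (fourier 1 : C(UnitAddCircle, ℂ)) t = y t * y t := congrArg (fun f => f t) hy
    rw [fourier_coe_apply] at h
    simp only [Pi.pow_apply]
    rw [sq, ← h, ← Complex.exp_nat_mul]
    congr 1
    push_cast
    ring
  have h01 : y ((1 : ℝ) : UnitAddCircle) = y ((0 : ℝ) : UnitAddCircle) := by
    rw [AddCircle.coe_period, AddCircle.coe_zero]
  rcases isPreconnected_univ.eq_or_eq_neg_of_sq_eq (by fun_prop) (by fun_prop) hsq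
    (fun {t} _ => hne t) with h | h
  · have h0 := h (Set.mem_univ 0)
    have h1 := h (Set.mem_univ 1)
    simp only [] at h0 h1
    rw [h01, h0] at h1
    norm_num at h1
  · have h0 := h (Set.mem_univ 0)
    have h1 := h (Set.mem_univ 1)
    simp only [Pi.neg_apply] at h0 h1
    rw [h01, h0] at h1
    norm_num at h1

open scoped ComplexOrder in
theorem exists_linearlyCompletelyIsometric_not_jordanIsomorphic :
    ∃ (H : Type) (_ : NormedAddCommGroup H) (_ : InnerProductSpace ℂ H) (_ : CompleteSpace H)
      (A B : Submodule ℂ (H →L[ℂ] H)), IsUnitalJCStarAlgebra A ∧ IsUnitalJCStarAlgebra B ∧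
        LinearlyCompletelyIsometric A B ∧ ¬ JordanIsomorphic A B := by
  obtain ⟨H, i₁, i₂, i₃, π, hπ⟩ := exists_faithful_representation_matrix_continuousMap
    (AddCircle.haarAddCircle (T := (1 : ℝ)))
  let z : C(UnitAddCircle, ℂ) := fourier 1
  have hz : z * star z = 1 := by
    ext t
    simp [z, Complex.mul_conj', Circle.norm_coe]
  exact ⟨H, i₁, i₂, i₃, _, _,
    isUnitalJCStarAlgebra_map_twistedSymmetric π hπ (w := 1) (by rw [star_one, mul_one]),
    isUnitalJCStarAlgebra_map_twistedSymmetric π hπ hz,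
    linearlyCompletelyIsometric_twistedSymmetric π hz,
    not_jordanIsomorphic_twistedSymmetric not_isSquare_fourier_one π hπ⟩

theorem proposition4p3 :
    -- linearly completely isometric, but not Jordan isomorphic
    (∃ (H K : Type) (_ : NormedAddCommGroup H) (_ : InnerProductSpace ℂ H) (_ : CompleteSpace H)
      (_ : NormedAddCommGroup K) (_ : InnerProductSpace ℂ K) (_ : CompleteSpace K)
      (A : Submodule ℂ (H →L[ℂ] H)) (B : Submodule ℂ (K →L[ℂ] K)),
      IsUnitalJCStarAlgebra A ∧ IsUnitalJCStarAlgebra B ∧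
        LinearlyCompletelyIsometric A B ∧ ¬ JordanIsomorphic A B) ∧
    -- Jordan `*`-isomorphic, but not linearly completely isometric
    (∃ (H K : Type) (_ : NormedAddCommGroup H) (_ : InnerProductSpace ℂ H) (_ : CompleteSpace H)
      (_ : NormedAddCommGroup K) (_ : InnerProductSpace ℂ K) (_ : CompleteSpace K)
      (A : Submodule ℂ (H →L[ℂ] H)) (B : Submodule ℂ (K →L[ℂ] K)),
      IsUnitalJCStarAlgebra A ∧ IsUnitalJCStarAlgebra B ∧
        JordanStarIsomorphic A B ∧ ¬ LinearlyCompletelyIsometric A B) ∧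
    -- the example `M_n` and `{(x, xᵀ)} ⊆ M_n ⊕ M_n`, and the transpose
    (∀ n : ℕ, 2 ≤ n →
      IsUnitalJCStarAlgebra (matrixAlgebra n) ∧
      IsUnitalJCStarAlgebra (diagTransposeAlgebra n) ∧
      (∃ T : matrixAlgebra n ≃ₗ[ℂ] diagTransposeAlgebra n,
        IsJordanStarIso T ∧ ∀ x : matrixAlgebra n,
          (T x : EuclideanSpace ℂ (Fin n ⊕ Fin n) →L[ℂ] EuclideanSpace ℂ (Fin n ⊕ Fin n)) =
            diagTranspose n x) ∧
      ¬ LinearlyCompletelyIsometric (matrixAlgebra n) (diagTransposeAlgebra n) ∧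
      ¬ IsCompletelyIsometric (matrixAlgebra n) (fun x => transposeOp n x)) := by
  refine ⟨?_, ?_, fun n hn => ⟨isUnitalJCStarAlgebra_matrixAlgebra n (by lia),
    isUnitalJCStarAlgebra_diagTransposeAlgebra n (by lia),
    ⟨diagTransposeEquiv n, isJordanStarIso_diagTransposeEquiv n, diagTransposeEquiv_apply n⟩,
    not_linearlyCompletelyIsometric_diagTransposeAlgebra hn,
    not_isCompletelyIsometric_transposeOp hn⟩⟩
  · obtain ⟨H, i₁, i₂, i₃, A, B, h⟩ := exists_linearlyCompletelyIsometric_not_jordanIsomorphic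
    exact ⟨H, H, i₁, i₂, i₃, i₁, i₂, i₃, A, B, h⟩
  · exact ⟨_, _, _, _, inferInstance, _, _, inferInstance, matrixAlgebra 2,
      diagTransposeAlgebra 2, isUnitalJCStarAlgebra_matrixAlgebra 2 two_ne_zero,
      isUnitalJCStarAlgebra_diagTransposeAlgebra 2 two_ne_zero,
      ⟨diagTransposeEquiv 2, isJordanStarIso_diagTransposeEquiv 2⟩,
      not_linearlyCompletelyIsometric_diagTransposeAlgebra le_rfl⟩
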